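/- Let $G\rightrightarrows P$ be a (real, finite-dimensional, smooth) Lie groupoid with source and target maps $\mathsf s,\mathsf t$ (surjective submersions), object inclusion $\epsilon\colon p\mapsto 1_p$ and multiplication $\mathsf m$ defined on $\{(g,h) : \mathsf s(g)=\mathsf t(h)\}$. Let $TG\rightrightarrows TP$ be its tangent prolongation (structure maps $T\mathsf s,T\mathsf t,T\epsilon,T\mathsf m$). With $A_pG=\ker(T_{1_p}\mathsf t)$, let $T^*G\rightrightarrows A^*G$ be the cotangent groupoid: $\hat{\mathsf s}(\alpha_g)(u)=\alpha_g(TL_g u)$ for $u\in A_{\mathsf s(g)}G$, $\hat{\mathsf t}(\alpha_g)(u)=\alpha_g(TR_g(u-T(\epsilon\circ\mathsf s) u))$ for $u\in A_{\mathsf t(g)}G$, the unit at $\varphi\in A_p^*G$ is the extension of $\varphi$ by zero on $T\epsilon(T_pP)$, and the product of $\alpha_g,\beta_h$ with $\hat{\mathsf s}(\alpha_g)=\hat{\mathsf t}(\beta_h)$ is the covector at $gh$ determined by $(\alpha_g\star\beta_h)(v_g\star w_h)=\alpha_g(v_g)+\beta_h(w_h)$ for all composable $v_g,w_h$. The Pontryagin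 groupoid is $TG\times_GT^*G\rightrightarrows TP\times_PA^*G$ with the componentwise structure. Let $\mathsf D_G\subseteq TG\times_GT^*G$ be a multiplicative Dirac structure, that is, a smooth vector subbundle that equals its own orthogonal for the pairing $\langle(v,\alpha),(w,\beta)\rangle=\alpha(w)+\beta(v)$ and that is a subgroupoid of the Pontryagin groupoid; so $(G\rightrightarrows P,\mathsf D_G)$ is a Dirac groupoid. (No integrability of $\mathsf D_G$ is assumed.) Then the characteristic distribution $\mathsf G_0=\{v\in TG : (v,0)\in\mathsf D_G\}$, which need be neither smooth nor of constant rank, is a set-theoretic subgroupoid of $TG\rightrightarrows TP$ over $TP\cap\mathsf G_0=\{x\in TP : T\epsilon(x)\in\mathsf G_0\}$. That is, $T\mathsf s$ and $T\mathsf t$ map $\mathsf G_0$ into $TP\cap\mathsf G_0$; the unit $T\epsilon(x)$ of every $x\in TP\cap\mathsf G_0$ lies in $\mathsf G_0$; if $v,w\in\mathsf G_0$ and $T\mathsf s(v)=T\mathsf t(w)$, then $v\star w\in\mathsf G_0$; and every $v\in\mathsf G_0$ has its inverse $v^{-1}$ in $\mathsf G_0$. -/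

import Mathlib

open scoped Manifold ContDiff
open Bundle

noncomputable section

namespace DiracGpd

/-! ### Groupoids with a partial multiplication, and set-theoretic subgroupoids -/

/-- The structure maps of a groupoid `G ⇉ P`: source, target, object inclusion, and the graph of the
partial multiplication (`IsMul g h k` means that `g ⋆ h` is defined and equal to `k`). -/
structure GroupoidMaps (G P : Type*) where
  src : G → P
  tgt : G → P
  one : P → G
  IsMul : G → G → G → Prop

/-- A pair of subsets `S ⊆ G` and `B ⊆ P` is a (set-theoretic) subgroupoid `S ⇉ B` of `G ⇉ P`:
the source, target, object inclusion and partial multiplication restrict to `S ⇉ B`, and `S` contains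
an inverse of each of its elements. -/
structure GroupoidMaps.IsSubgroupoid {G P : Type*} (Γ : GroupoidMaps G P)
    (S : Set G) (B : Set P) : Prop where
  src_mem : ∀ g ∈ S, Γ.src g ∈ B
  tgt_mem : ∀ g ∈ S, Γ.tgt g ∈ B
  one_mem : ∀ p ∈ B, Γ.one p ∈ S
  mul_mem : ∀ g ∈ S, ∀ h ∈ S, ∀ k, Γ.IsMul g h k → k ∈ S
  inv_mem : ∀ g ∈ S, ∃ g' ∈ S, Γ.src g' = Γ.tgt g ∧ Γ.tgt g' = Γ.src g ∧
    Γ.IsMul g g' (Γ.one (Γ.tgt g)) ∧ Γ.IsMul g' g (Γ.one (Γ.src g))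

/-! ### Lie groupoids -/

section

variable (E F G P : Type*)
  [NormedAddCommGroup E] [NormedSpace ℝ E] [NormedAddCommGroup F] [NormedSpace ℝ F]
  [TopologicalSpace G] [ChartedSpace E G] [IsManifold 𝓘(ℝ, E) ∞ G]
  [TopologicalSpace P] [ChartedSpace F P] [IsManifold 𝓘(ℝ, F) ∞ P]

/-- A Lie groupoid `G ⇉ P`. The multiplication is written as a total function, but only its values
on composable pairs `src g = tgt h` carry information. Smoothness of the multiplication on the
embedded submanifold of composable pairs is smoothness within that subset of `G × G`. -/
structure LieGroupoid where
  src : G → P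
  tgt : G → P
  one : P → G
  mul : G → G → G
  src_mul : ∀ g h, src g = tgt h → src (mul g h) = src h
  tgt_mul : ∀ g h, src g = tgt h → tgt (mul g h) = tgt g
  mul_assoc : ∀ g h l, src g = tgt h → src h = tgt l → mul (mul g h) l = mul g (mul h l)
  src_one : ∀ p, src (one p) = p
  tgt_one : ∀ p, tgt (one p) = p
  mul_one : ∀ g, mul g (one (src g)) = g
  one_mul : ∀ g, mul (one (tgt g)) g = g
  exists_inv : ∀ g, ∃ g', src g' = tgt g ∧ tgt g' = src g ∧
    mul g g' = one (tgt g) ∧ mul g' g = one (src g)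
  src_surjective : Function.Surjective src
  tgt_surjective : Function.Surjective tgt
  src_submersion : Manifold.IsSubmersion 𝓘(ℝ, E) 𝓘(ℝ, F) ∞ src
  tgt_submersion : Manifold.IsSubmersion 𝓘(ℝ, E) 𝓘(ℝ, F) ∞ tgt
  one_smooth : ContMDiff 𝓘(ℝ, F) 𝓘(ℝ, E) ∞ one
  mul_smooth : ContMDiffOn (𝓘(ℝ, E).prod 𝓘(ℝ, E)) 𝓘(ℝ, E) ∞
    (fun x : G × G => mul x.1 x.2) {x : G × G | src x.1 = tgt x.2}

end

section

variable {E F G P : Type*}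
  [NormedAddCommGroup E] [NormedSpace ℝ E] [NormedAddCommGroup F] [NormedSpace ℝ F]
  [TopologicalSpace G] [ChartedSpace E G] [IsManifold 𝓘(ℝ, E) ∞ G]
  [TopologicalSpace P] [ChartedSpace F P] [IsManifold 𝓘(ℝ, F) ∞ P]

/-! ### The tangent groupoid -/

/-- The tangent prolongation `TG ⇉ TP`, whose structure maps are the tangent maps of those of
`G ⇉ P`. The tangent space of the submanifold of composable pairs at `(g, h)` consists of the
`(v, w) ∈ T_g G × T_h G` with `T s v = T t w`, and on these vectors the derivative of the
multiplication within the set of composable pairs is the tangent map of the multiplication. -/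
def LieGroupoid.tangent (Γ : LieGroupoid E F G P) :
    GroupoidMaps (TangentBundle 𝓘(ℝ, E) G) (TangentBundle 𝓘(ℝ, F) P) where
  src := tangentMap 𝓘(ℝ, E) 𝓘(ℝ, F) Γ.src
  tgt := tangentMap 𝓘(ℝ, E) 𝓘(ℝ, F) Γ.tgt
  one := tangentMap 𝓘(ℝ, F) 𝓘(ℝ, E) Γ.one
  IsMul x y z :=
    tangentMap 𝓘(ℝ, E) 𝓘(ℝ, F) Γ.src x = tangentMap 𝓘(ℝ, E) 𝓘(ℝ, F) Γ.tgt y ∧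
    z = ⟨Γ.mul x.1 y.1,
      mfderivWithin (𝓘(ℝ, E).prod 𝓘(ℝ, E)) 𝓘(ℝ, E) (fun q : G × G => Γ.mul q.1 q.2)
        {q : G × G | Γ.src q.1 = Γ.tgt q.2} (x.1, y.1) (x.2, y.2)⟩

/-! ### The cotangent groupoid -/

/-- The fibre `A_p G = ker (T t) ⊆ T_{1_p} G` of the Lie algebroid. -/
abbrev LieGroupoid.A (Γ : LieGroupoid E F G P) (p : P) :
    Submodule ℝ (TangentSpace 𝓘(ℝ, E) (Γ.one p)) :=
  LinearMap.ker (mfderiv 𝓘(ℝ, E) 𝓘(ℝ, F) Γ.tgt (Γ.one p)).toLinearMap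

/-- The fibre `A_p^* G` of the dual of the Lie algebroid. -/
abbrev LieGroupoid.ADual (Γ : LieGroupoid E F G P) (p : P) : Type _ := Γ.A p →L[ℝ] ℝ

variable (E G) in
/-- The cotangent bundle `T^*G`. -/
abbrev CotangentSpace (g : G) : Type _ := TangentSpace 𝓘(ℝ, E) g →L[ℝ] ℝ

variable (E G) in
/-- The total space of the cotangent bundle `T^*G`. -/
abbrev CotangentBundle : Type _ := TotalSpace (E →L[ℝ] ℝ) (CotangentSpace E G)

/-- The tangent map at the unit `1_{s(g)}` of the left translation
`L_g : t⁻¹(s(g)) → t⁻¹(t(g))`; it is meaningful on `A_{s(g)} G`, the tangent space of the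
fibre `t⁻¹(s(g))`. -/
def LieGroupoid.dLeft (Γ : LieGroupoid E F G P) (g : G) :
    TangentSpace 𝓘(ℝ, E) (Γ.one (Γ.src g)) →L[ℝ] TangentSpace 𝓘(ℝ, E) g :=
  mfderivWithin 𝓘(ℝ, E) 𝓘(ℝ, E) (fun h => Γ.mul g h) {h | Γ.tgt h = Γ.src g} (Γ.one (Γ.src g))

/-- The tangent map at the unit `1_{t(g)}` of the right translation
`R_g : s⁻¹(t(g)) → s⁻¹(s(g))`; it is meaningful on the kernel of `T s`, the tangent space of the
fibre `s⁻¹(t(g))`. -/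
def LieGroupoid.dRight (Γ : LieGroupoid E F G P) (g : G) :
    TangentSpace 𝓘(ℝ, E) (Γ.one (Γ.tgt g)) →L[ℝ] TangentSpace 𝓘(ℝ, E) g :=
  mfderivWithin 𝓘(ℝ, E) 𝓘(ℝ, E) (fun h => Γ.mul h g) {h | Γ.src h = Γ.tgt g} (Γ.one (Γ.tgt g))

/-- The endomorphism `u ↦ T(ε ∘ s) u` of `T_{1_p} G`. -/
def LieGroupoid.dSrcUnit (Γ : LieGroupoid E F G P) (p : P) :
    TangentSpace 𝓘(ℝ, E) (Γ.one p) →L[ℝ] TangentSpace 𝓘(ℝ, E) (Γ.one p) :=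
  mfderiv 𝓘(ℝ, E) 𝓘(ℝ, E) (fun g => Γ.one (Γ.src g)) (Γ.one p)

/-- The endomorphism `u ↦ T(ε ∘ t) u` of `T_{1_p} G`. -/
def LieGroupoid.dTgtUnit (Γ : LieGroupoid E F G P) (p : P) :
    TangentSpace 𝓘(ℝ, E) (Γ.one p) →L[ℝ] TangentSpace 𝓘(ℝ, E) (Γ.one p) :=
  mfderiv 𝓘(ℝ, E) 𝓘(ℝ, E) (fun g => Γ.one (Γ.tgt g)) (Γ.one p)

set_option linter.unusedSectionVars false in
lemma LieGroupoid.sub_dTgtUnit_mem (Γ : LieGroupoid E F G P) (p : P)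
    (u : TangentSpace 𝓘(ℝ, E) (Γ.one p)) : u - Γ.dTgtUnit p u ∈ Γ.A p := by
  have ht : MDifferentiable 𝓘(ℝ, E) 𝓘(ℝ, F) Γ.tgt :=
    Γ.tgt_submersion.contMDiff.mdifferentiable (by simp)
  have ho : MDifferentiable 𝓘(ℝ, F) 𝓘(ℝ, E) Γ.one := Γ.one_smooth.mdifferentiable (by simp)
  have hc : Γ.tgt ∘ (fun g => Γ.one (Γ.tgt g)) = Γ.tgt := funext fun g => Γ.tgt_one _
  have key : ∀ q, q = Γ.one p →
      (mfderiv 𝓘(ℝ, E) 𝓘(ℝ, F) Γ.tgt q : E →L[ℝ] F) = mfderiv 𝓘(ℝ, E) 𝓘(ℝ, F) Γ.tgt (Γ.one p) := by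
    rintro q rfl; rfl
  have h := mfderiv_comp (I := 𝓘(ℝ, E)) (I' := 𝓘(ℝ, E)) (I'' := 𝓘(ℝ, F)) (Γ.one p)
    (g := Γ.tgt) (f := fun g => Γ.one (Γ.tgt g)) (ht _) ((ho _).comp _ (ht _))
  rw [hc] at h
  have h1 := congrArg (fun L : E →L[ℝ] F => L u) h
  have h2 := congrArg (fun L : E →L[ℝ] F => L (Γ.dTgtUnit p u)) (key _ (congrArg Γ.one (Γ.tgt_one p)))
  rw [LinearMap.mem_ker]
  refine (map_sub _ _ _).trans (sub_eq_zero.2 ?_)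
  exact h1.trans h2

/-- The projection `u ↦ u - T(ε ∘ t) u` of `T_{1_p} G = T_p P ⊕ A_p G` onto `A_p G`. -/
def LieGroupoid.projA (Γ : LieGroupoid E F G P) (p : P) :
    TangentSpace 𝓘(ℝ, E) (Γ.one p) →L[ℝ] Γ.A p :=
  (ContinuousLinearMap.id ℝ _ - Γ.dTgtUnit p).codRestrict (Γ.A p) (Γ.sub_dTgtUnit_mem p)

/-- The cotangent groupoid `T^*G ⇉ A^*G`: source and target are
`ŝ(α_g)(u) = α_g (T L_g u)` and `t̂(α_g)(u) = α_g (T R_g (u - T s u))`, the unit at `φ ∈ A_p^*G` is the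
covector at `1_p` extending `φ` by zero on `T_p P`, and the product of `α_g` and `β_h`
with `ŝ(α_g) = t̂(β_h)` is the covector at `g ⋆ h` with
`(α_g ⋆ β_h)(v_g ⋆ w_h) = α_g(v_g) + β_h(w_h)` for all composable `v_g`, `w_h`. -/
def LieGroupoid.cotangent (Γ : LieGroupoid E F G P) :
    GroupoidMaps (CotangentBundle E G) (Σ p : P, Γ.ADual p) where
  src α := ⟨Γ.src α.1, α.2.comp ((Γ.dLeft α.1).comp (Γ.A (Γ.src α.1)).subtypeL)⟩
  tgt α := ⟨Γ.tgt α.1, α.2.comp ((Γ.dRight α.1).comp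
    ((ContinuousLinearMap.id ℝ _ - Γ.dSrcUnit (Γ.tgt α.1)).comp (Γ.A (Γ.tgt α.1)).subtypeL))⟩
  one φ := ⟨Γ.one φ.1, φ.2.comp (Γ.projA φ.1)⟩
  IsMul α β γ :=
    (⟨Γ.src α.1, α.2.comp ((Γ.dLeft α.1).comp (Γ.A (Γ.src α.1)).subtypeL)⟩ :
        Σ p : P, Γ.ADual p) =
      ⟨Γ.tgt β.1, β.2.comp ((Γ.dRight β.1).comp
        ((ContinuousLinearMap.id ℝ _ - Γ.dSrcUnit (Γ.tgt β.1)).comp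
          (Γ.A (Γ.tgt β.1)).subtypeL))⟩ ∧
    γ.1 = Γ.mul α.1 β.1 ∧
    ∀ (v : TangentSpace 𝓘(ℝ, E) α.1) (w : TangentSpace 𝓘(ℝ, E) β.1)
      (u : TangentSpace 𝓘(ℝ, E) γ.1), Γ.tangent.IsMul ⟨α.1, v⟩ ⟨β.1, w⟩ ⟨γ.1, u⟩ →
      γ.2 u = α.2 v + β.2 w

/-! ### The Pontryagin groupoid -/

variable (E G) in
/-- The fibre `T_g G × T_g^* G` of the Pontryagin bundle. -/
abbrev PontryaginSpace (g : G) : Type _ := (TangentSpace 𝓘(ℝ, E) ×ᵇ CotangentSpace E G) g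

variable (E G) in
/-- The total space of the Pontryagin bundle `TG ×_G T^*G`. -/
abbrev PontryaginBundle : Type _ :=
  TotalSpace (E × (E →L[ℝ] ℝ)) (TangentSpace 𝓘(ℝ, E) ×ᵇ CotangentSpace E G)

/-- The tangent component of an element of the Pontryagin bundle. -/
def PontryaginBundle.vec (x : PontryaginBundle E G) : TangentBundle 𝓘(ℝ, E) G := ⟨x.1, x.2.1⟩

/-- The cotangent component of an element of the Pontryagin bundle. -/
def PontryaginBundle.cov (x : PontryaginBundle E G) : CotangentBundle E G := ⟨x.1, x.2.2⟩

/-- The Pontryagin groupoid `TG ×_G T^*G ⇉ TP ×_P A^*G`, with componentwise structure maps. -/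
def LieGroupoid.pontryagin (Γ : LieGroupoid E F G P) :
    GroupoidMaps (PontryaginBundle E G) (Σ p : P, TangentSpace 𝓘(ℝ, F) p × Γ.ADual p) where
  src x := ⟨Γ.src x.1, (Γ.tangent.src x.vec).2, (Γ.cotangent.src x.cov).2⟩
  tgt x := ⟨Γ.tgt x.1, (Γ.tangent.tgt x.vec).2, (Γ.cotangent.tgt x.cov).2⟩
  one b := ⟨Γ.one b.1, (Γ.tangent.one ⟨b.1, b.2.1⟩).2, (Γ.cotangent.one ⟨b.1, b.2.2⟩).2⟩
  IsMul x y z := Γ.tangent.IsMul x.vec y.vec z.vec ∧ Γ.cotangent.IsMul x.cov y.cov z.cov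

/-! ### Dirac structures and Dirac groupoids -/

variable (E G) in
/-- A Dirac structure on the manifold `G` modelled on `E`: a smooth vector subbundle `D` of
the Pontryagin bundle (it has smooth local frames) which is Lagrangian, that is, equal
to its own orthogonal for the pairing `⟨(v, α), (w, β)⟩ = α(w) + β(v)`. -/
structure DiracStructure where
  fiber : ∀ g : G, Submodule ℝ (PontryaginSpace E G g)
  exists_frame : ∀ g : G, ∃ U : Set G, IsOpen U ∧ g ∈ U ∧
    ∃ (r : ℕ) (σ : Fin r → ∀ x : G, PontryaginSpace E G x),
      (∀ i, ContMDiffOn 𝓘(ℝ, E) (𝓘(ℝ, E).prod 𝓘(ℝ, E × (E →L[ℝ] ℝ))) ∞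
        (fun x => TotalSpace.mk' (E × (E →L[ℝ] ℝ)) (E := PontryaginSpace E G) x (σ i x)) U) ∧
      ∀ x ∈ U, LinearIndependent ℝ (fun i => σ i x) ∧
        Submodule.span ℝ (Set.range fun i => σ i x) = fiber x
  lagrangian : ∀ (g : G) (x : PontryaginSpace E G g),
    x ∈ fiber g ↔ ∀ y ∈ fiber g, x.2 y.1 + y.2 x.1 = 0

/-- The total space of a Dirac structure. -/
def DiracStructure.total (D : DiracStructure E G) :
    Set (PontryaginBundle E G) :=
  {x | x.2 ∈ D.fiber x.1}

/-- The characteristic distribution `G₀ = {v | (v, 0) ∈ D} ⊆ TG`. -/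
def DiracStructure.G0 (D : DiracStructure E G) :
    Set (TangentBundle 𝓘(ℝ, E) G) :=
  {v | ((v.2, 0) : PontryaginSpace E G v.1) ∈ D.fiber v.1}

/-- The Dirac structure `D` is multiplicative, that is, `(G ⇉ P, D)` is a Dirac groupoid:
the subbundle `D` is a subgroupoid of the Pontryagin groupoid (over some set of units). Its smooth
structure is the one of a smooth vector subbundle; for such a `D`, being closed under the structure
maps already makes it an embedded Lie subgroupoid, over a vector subbundle of `TP ×_P A^*G`. -/
def LieGroupoid.IsDirac (Γ : LieGroupoid E F G P)
    (D : DiracStructure E G) : Prop :=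
  ∃ U : Set (Σ p : P, TangentSpace 𝓘(ℝ, F) p × Γ.ADual p), Γ.pontryagin.IsSubgroupoid D.total U

end

end DiracGpd

end

/-!
For `v ∈ G₀` the element `(v, 0)` of `D` has source and target with zero covector part, and the unit
over `(x, 0)` is `(Tε x, 0)`; also `0_g ⋆ 0_h = 0_{gh}` whenever `g` and `h` are composable. So source,
target, unit and product restrict to `G₀` directly because they restrict to `D`.

For inverses, `D` provides some `(v', α')` inverse to `(v, 0)`, and the point is that `α' = 0`. The product
`0 ⋆ α'` is the unit over `t̂(0) = 0`, which is the zero covector. Hence `α' w = 0 + α' w = 0` for each `w`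
that can be composed with some `u ∈ T_g G`. As `s` is a submersion, `T_g s` is onto
(`Manifold.IsSubmersionAt.surjective_mfderiv`), so each `w` has this property.
-/

section Submersion

variable {𝕜 E E' M N : Type*} [NontriviallyNormedField 𝕜]
  [NormedAddCommGroup E] [NormedSpace 𝕜 E] [NormedAddCommGroup E'] [NormedSpace 𝕜 E']
  [TopologicalSpace M] [ChartedSpace E M] [TopologicalSpace N] [ChartedSpace E' N]

theorem OpenPartialHomeomorph.MDifferentiable.of_mem_maximalAtlas {e : OpenPartialHomeomorph M E}
    (he : e ∈ IsManifold.maximalAtlas 𝓘(𝕜, E) 1 M) : e.MDifferentiable 𝓘(𝕜, E) 𝓘(𝕜, E) :=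
  ⟨fun _ hy => (mdifferentiableAt_of_mem_maximalAtlas he hy).mdifferentiableWithinAt,
    fun _ hy => (mdifferentiableAt_symm_of_mem_maximalAtlas he hy).mdifferentiableWithinAt⟩

/-- In suitable charts `φ` and `ψ` the map is a linear projection `A`, so `ψ ∘ f = A ∘ φ` near `x`, where
`A` is onto and the derivatives of `φ` and `ψ` are bijective. -/
theorem Manifold.IsSubmersionAt.surjective_mfderiv {n : WithTop ℕ∞}
    [IsManifold 𝓘(𝕜, E) n M] [IsManifold 𝓘(𝕜, E') n N] {f : M → N} {x : M}
    (hf : Manifold.IsSubmersionAt 𝓘(𝕜, E) 𝓘(𝕜, E') n f x) (hn : n ≠ 0) :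
    Function.Surjective (mfderiv 𝓘(𝕜, E) 𝓘(𝕜, E') f x) := by
  have hn1 : 1 ≤ n := ENat.one_le_iff_ne_zero_withTop.mpr hn
  set φ := hf.domChart
  set ψ := hf.codChart
  have hx : x ∈ φ.source := hf.mem_domChart_source
  have hfx : f x ∈ ψ.source := hf.mem_codChart_source
  have hφ : φ.MDifferentiable 𝓘(𝕜, E) 𝓘(𝕜, E) :=
    .of_mem_maximalAtlas (IsManifold.maximalAtlas_subset_of_le hn1 hf.domChart_mem_maximalAtlas)
  have hψ : ψ.MDifferentiable 𝓘(𝕜, E') 𝓘(𝕜, E') :=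
    .of_mem_maximalAtlas (IsManifold.maximalAtlas_subset_of_le hn1 hf.codChart_mem_maximalAtlas)
  let A : E →L[𝕜] E' :=
    (ContinuousLinearMap.fst 𝕜 E' hf.complement).comp (hf.equiv : E →L[𝕜] E' × hf.complement)
  have heq : (fun y => ψ (f y)) =ᶠ[nhds x] fun y => A (φ y) := by
    filter_upwards [φ.open_source.mem_nhds hx] with y hy
    have hy' : φ y ∈ (φ.extend 𝓘(𝕜, E)).target := by simpa using φ.map_source hy
    have h := hf.writtenInCharts hy'
    simpa [φ.left_inv hy, A, φ, ψ] using h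
  have hfd : MDifferentiableAt 𝓘(𝕜, E) 𝓘(𝕜, E') f x := hf.contMDiffAt.mdifferentiableAt hn
  have h1 := (hψ.mdifferentiableAt hfx).hasMFDerivAt.comp x hfd.hasMFDerivAt
  have h2 := (A.hasMFDerivAt (x := φ x)).comp x (hφ.mdifferentiableAt hx).hasMFDerivAt
  have h3 := hasMFDerivAt_unique h1 (h2.congr_of_eventuallyEq heq)
  intro w
  obtain ⟨v, hv⟩ := hφ.mfderiv_surjective hx
    (hf.equiv.symm (mfderiv 𝓘(𝕜, E') 𝓘(𝕜, E') ψ (f x) w, 0))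
  refine ⟨v, hψ.mfderiv_injective hfx ?_⟩
  refine (DFunLike.congr_fun h3 v).trans ((congrArg A hv).trans ?_)
  simp [A]
  rfl

end Submersion

namespace DiracGpd

variable {E F G P : Type*}
  [NormedAddCommGroup E] [NormedSpace ℝ E] [NormedAddCommGroup F] [NormedSpace ℝ F]
  [TopologicalSpace G] [ChartedSpace E G] [IsManifold 𝓘(ℝ, E) ∞ G]
  [TopologicalSpace P] [ChartedSpace F P] [IsManifold 𝓘(ℝ, F) ∞ P]

/-- The element `(v, 0)` of the Pontryagin bundle. -/
noncomputable def PontryaginBundle.ofVec (v : TangentBundle 𝓘(ℝ, E) G) : PontryaginBundle E G :=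
  ⟨v.1, (v.2, 0)⟩

namespace LieGroupoid

variable (Γ : LieGroupoid E F G P)

set_option linter.unusedSectionVars false in
lemma src_eq_tgt_of_isMul {x y z : TangentBundle 𝓘(ℝ, E) G} (h : Γ.tangent.IsMul x y z) :
    Γ.src x.1 = Γ.tgt y.1 :=
  congrArg TotalSpace.proj h.1

/-- The zero covectors are closed under composable products: `0_g ⋆ 0_h = 0_{gh}`. -/
lemma pontryagin_isMul_ofVec {x y z : TangentBundle 𝓘(ℝ, E) G} (h : Γ.tangent.IsMul x y z) :
    Γ.pontryagin.IsMul (.ofVec x) (.ofVec y) (.ofVec z) := by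
  refine ⟨h, ?_, congrArg TotalSpace.proj h.2, fun v w u _ => (add_zero (0 : ℝ)).symm⟩
  have key : ∀ p q : P, p = q → (⟨p, 0⟩ : Σ p : P, Γ.ADual p) = ⟨q, 0⟩ := by
    rintro p _ rfl; rfl
  exact key _ _ (Γ.src_eq_tgt_of_isMul h)

/-- Each tangent vector at `h` can be composed on its left with some tangent vector at `g`,
because `T_g s` is onto. -/
lemma exists_tangent_isMul {g h : G} (hgh : Γ.src g = Γ.tgt h) (w : TangentSpace 𝓘(ℝ, E) h) :
    ∃ (v : TangentSpace 𝓘(ℝ, E) g) (u : TangentSpace 𝓘(ℝ, E) (Γ.mul g h)),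
      Γ.tangent.IsMul ⟨g, v⟩ ⟨h, w⟩ ⟨Γ.mul g h, u⟩ := by
  obtain ⟨v, hv⟩ := (Γ.src_submersion.isSubmersionAt g).surjective_mfderiv (by simp)
    (mfderiv 𝓘(ℝ, E) 𝓘(ℝ, F) Γ.tgt h w : F)
  refine ⟨v, _, ?_, rfl⟩
  have key : ∀ (p q : P) (a b : F), p = q → a = b →
      (⟨p, a⟩ : TangentBundle 𝓘(ℝ, F) P) = ⟨q, b⟩ := by
    rintro p _ a _ rfl rfl; rfl
  exact key _ _ _ _ hgh hv

/-- A covector `β` is determined by `α ⋆ β` and `α`; here for `α` and `α ⋆ β` both zero. -/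
lemma eq_zero_of_cotangent_isMul {g h k : G} (hgh : Γ.src g = Γ.tgt h) {β : CotangentSpace E G h}
    (hm : Γ.cotangent.IsMul ⟨g, 0⟩ ⟨h, β⟩ ⟨k, 0⟩) : β = 0 := by
  obtain ⟨-, hk, hm⟩ := hm
  dsimp only at hk
  subst hk
  ext w
  obtain ⟨v, u, hvu⟩ := Γ.exists_tangent_isMul hgh w
  exact ((zero_add (β w)).symm.trans (hm v w u hvu).symm)

end LieGroupoid

end DiracGpd

theorem mainTheorem7 {E F G P : Type*}
    [NormedAddCommGroup E] [NormedSpace ℝ E] [FiniteDimensional ℝ E]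
    [NormedAddCommGroup F] [NormedSpace ℝ F] [FiniteDimensional ℝ F]
    [TopologicalSpace G] [ChartedSpace E G] [IsManifold 𝓘(ℝ, E) ∞ G]
    [TopologicalSpace P] [ChartedSpace F P] [IsManifold 𝓘(ℝ, F) ∞ P]
    (Γ : DiracGpd.LieGroupoid E F G P) (D : DiracGpd.DiracStructure E G) (hD : Γ.IsDirac D) :
    Γ.tangent.IsSubgroupoid D.G0 {v : TangentBundle 𝓘(ℝ, F) P | Γ.tangent.one v ∈ D.G0} := by
  obtain ⟨U, hU⟩ := hD
  refine ⟨fun v hv => ?_, fun v hv => ?_, fun x hx => hx, fun v hv w hw z hz => ?_,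
    fun v hv => ?_⟩
  -- The Pontryagin source of `(v, 0)` is `(Ts v, 0)`, and the unit over it is `(Tε (Ts v), 0)`.
  · exact hU.one_mem _ (hU.src_mem (.ofVec v) hv)
  · exact hU.one_mem _ (hU.tgt_mem (.ofVec v) hv)
  · exact hU.mul_mem (.ofVec v) hv (.ofVec w) hw (.ofVec z) (Γ.pontryagin_isMul_ofVec hz)
  · obtain ⟨x, hx, hs, ht, hm, hm'⟩ := hU.inv_mem (.ofVec v) hv
    have hx0 : x.2.2 = 0 := Γ.eq_zero_of_cotangent_isMul (Γ.src_eq_tgt_of_isMul hm.1) hm.2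
    refine ⟨x.vec, ?_, congrArg (fun b => (⟨b.1, b.2.1⟩ : TangentBundle 𝓘(ℝ, F) P)) hs,
      congrArg (fun b => (⟨b.1, b.2.1⟩ : TangentBundle 𝓘(ℝ, F) P)) ht, hm.1, hm'.1⟩
    have hx' : (x.2.1, (0 : DiracGpd.CotangentSpace E G x.1)) = x.2 := Prod.ext rfl hx0.symm
    exact (congrArg (· ∈ D.fiber x.1) hx').mpr hx
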